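/- **Setting.** Let $R$ be a commutative ring with unity, $n\ge 0$, $x=(x_1,\dots,x_n)$, $y=(y_1,\dots,y_n)$ variables, and $f=(f_1,\dots,f_n)$ a system of $n$ polynomials in $R[x]$. For $d\in\mathbb Z$ let $R[x^{\le d}]$ be the set of polynomials of total degree at most $d$ (which is $\{0\}$ for $d<0$). Put $\delta_f=\sum_{i=1}^n(\deg f_i-1)\in\mathbb Z$ (where $\deg 0:=0$), let $(f(x))_x$ be the ideal generated by $f_1,\dots,f_n$, and let $(f(x))_x^{\le d}=\{\sum_i f_i g_i : g_i\in R[x^{\le d-\deg f_i}]\}$. A functional is an $R$-linear map $R[x]\to R$; it annuls a set if it vanishes on it, and two functionals are equal in $R[x^{\le d}]$ if they agree on it. A difference derivative of $F\in R[x]$ is a tuple $\nabla F(x,y)=(\nabla^jF(x,y))_{j=1}^n$ of polynomials of total degree at most $\deg F-1$ in $(x,y)$ (zero if $\deg F=0$) with $F(x)-F(y)=\sum_j (x_j-y_j)\nabla^jF(x,y)$. Choose a difference derivative $\nabla f_i$ of each $f_i$, and an $R$-linear operator $\nabla_x$ that sends each $F\in R[x]$ to a difference derivative $\nabla F$ of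 $F$. For a functional $L$, let $L(y_*)$ denote $L$ acting on the variables $y$, coefficientwise in $x$. The extension operation is defined, for functionals $l,L$ and $F\in R[x]$, by $$L*F=L(y_*).\det\begin{Vmatrix}\nabla f(x,y)&\nabla F(x,y)\\ f(x)&F(x)\end{Vmatrix}\in R[x],\qquad (l*L)(F)=l(L*F).$$ It depends on the chosen difference derivatives; the theorem holds for all choices, and different choices may be used in the hypothesis $E'*1-1\in(f(x))_x$, in the products $E'*F$, $E'*l$, $E'*L'$, $E'*L$, and in the products $l*E'$, $L'*E'$, $L*E'$. **Theorem 5.** Let $\varepsilon\ge 0$ be an integer, and let $E'$ be a functional that annuls $(f(x))_x^{\le\delta_f+\varepsilon}$ and satisfies $E'*1-1\in(f(x))_x$. Then: 1. if $d\in\mathbb Z$ and $F\in R[x^{\le d}]$, then $E'*F\in R[x^{\le\max(\delta_f,\,d-\varepsilon-1)}]$ and $F-E'*F\in(f(x))_x\cap R[x^{\le\max(\delta_f,d)}]$; 2. if a functional $l$ annuls $(f(x))_x$, then $l=E'*l=l*E'$; 3. if a functional $l$ annuls $(f(x))_x$ and a functional $L'$ equals $l$ in $R[x^{\le\delta_f+\delta}]$,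 where $\delta\ge0$ is an integer, then $l=E'*L'=L'*E'$ in $R[x^{\le\delta_f+\delta+\varepsilon+1}]$; 4. if a functional $L$ annuls $(f(x))_x\cap R[x^{\le\delta_f+\delta}]$, where $\delta\ge0$ is an integer, then $L=E'*L=L*E'$ in $R[x^{\le\delta_f+\delta}]$; moreover $E'*L=L*E'$ in $R[x^{\le\delta_f+\delta+\varepsilon+1}]$, and both $E'*L$ and $L*E'$ annul $(f(x))_x\cap R[x^{\le\delta_f+\delta+\varepsilon+1}]$. -/

import Mathlib

namespace RootFunctional

open MvPolynomial

/-- `R[x^{≤ d}]`: the polynomials all of whose monomials have total degree at most the integer `d`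
(so it is `0` for negative `d`). -/
noncomputable def degLE (σ R : Type*) [CommRing R] (d : ℤ) : Submodule R (MvPolynomial σ R) :=
  restrictSupport R {m : σ →₀ ℕ | (m.degree : ℤ) ≤ d}

section

variable {R : Type*} [CommRing R] {n : ℕ}

/-- A polynomial `F(x)` viewed in `R[x, y]`; the variables `x` are those indexed by `Sum.inl`. -/
noncomputable def inX : MvPolynomial (Fin n) R →ₐ[R] MvPolynomial (Fin n ⊕ Fin n) R :=
  rename Sum.inl

/-- The polynomial `F(y)` in `R[x, y]`; the variables `y` are those indexed by `Sum.inr`. -/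
noncomputable def inY : MvPolynomial (Fin n) R →ₐ[R] MvPolynomial (Fin n ⊕ Fin n) R :=
  rename Sum.inr

/-- `v = (v_1, …, v_n)` is a difference derivative `∇F(x, y)` of `F`:
`F(x) - F(y) = ∑ j, (x_j - y_j) * v_j(x, y)`, where each `v_j` has total degree at most
`deg F - 1` in `(x, y)`. -/
def IsDiffDeriv (F : MvPolynomial (Fin n) R)
    (v : Fin n → MvPolynomial (Fin n ⊕ Fin n) R) : Prop :=
  inX F - inY F = ∑ j, (X (Sum.inl j) - X (Sum.inr j)) * v j ∧
    ∀ j, v j ∈ degLE (Fin n ⊕ Fin n) R ((F.totalDegree : ℤ) - 1)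

/-- A choice of the difference derivatives on which the extension operation depends: a difference
derivative `∇f_i(x, y)` of each polynomial of the system, and an `R`-linear operator `∇_x(x, y)`
that sends every polynomial to one of its difference derivatives. -/
structure NablaChoice (f : Fin n → MvPolynomial (Fin n) R) where
  /-- `nablaSys i j` is the component `j` of `∇f_i(x, y)`. -/
  nablaSys : Fin n → Fin n → MvPolynomial (Fin n ⊕ Fin n) R
  isDiffDeriv_nablaSys : ∀ i, IsDiffDeriv (f i) (nablaSys i)
  /-- The operator `∇_x(x, y)`. -/
  nabla : MvPolynomial (Fin n) R →ₗ[R] (Fin n → MvPolynomial (Fin n ⊕ Fin n) R)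
  isDiffDeriv_nabla : ∀ F, IsDiffDeriv F (nabla F)

/-- `L(y_*).G(x, y)`: the functional `L` applied to the variables `y`, with values in `R[x]`; the
`R`-linear map with `x^α y^β ↦ L(x^β) x^α`. -/
noncomputable def applyY (L : Module.Dual R (MvPolynomial (Fin n) R)) :
    MvPolynomial (Fin n ⊕ Fin n) R →ₗ[R] MvPolynomial (Fin n) R :=
  (basisMonomials (Fin n ⊕ Fin n) R).constr R fun m =>
    monomial (Finsupp.sumFinsuppEquivProdFinsupp m).1
      (L (monomial (Finsupp.sumFinsuppEquivProdFinsupp m).2 1))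

variable {f : Fin n → MvPolynomial (Fin n) R}

/-- The `(n + 1) × (n + 1)` matrix with block rows `(∇f(x, y), ∇F(x, y))` and `(f(x), F(x))`. -/
noncomputable def borderedMatrix (C : NablaChoice f) (F : MvPolynomial (Fin n) R) :
    Matrix (Fin n ⊕ Unit) (Fin n ⊕ Unit) (MvPolynomial (Fin n ⊕ Fin n) R) :=
  Matrix.fromBlocks (Matrix.of fun j i => C.nablaSys i j) (Matrix.of fun j _ => C.nabla F j)
    (Matrix.of fun _ i => inX (f i)) (Matrix.of fun _ _ => inX F)

theorem borderedMatrix_eq (C : NablaChoice f) (F : MvPolynomial (Fin n) R) :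
    borderedMatrix C F = (borderedMatrix C 0).updateCol (Sum.inr ())
      (Sum.elim (C.nabla F) fun _ => inX F) := by
  ext (i | i) (j | j) <;> simp [borderedMatrix]

/-- The operator `[L]` on `R[x]`, which sends `F` to
`L(y_*).det ‖∇f(x, y), ∇F(x, y); f(x), F(x)‖`. -/
noncomputable def extOp (C : NablaChoice f) (L : Module.Dual R (MvPolynomial (Fin n) R)) :
    MvPolynomial (Fin n) R →ₗ[R] MvPolynomial (Fin n) R :=
  applyY L ∘ₗ
    { toFun := fun F => (borderedMatrix C F).det
      map_add' := fun F G => by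
        rw [borderedMatrix_eq C (F + G), borderedMatrix_eq C F, borderedMatrix_eq C G,
          ← Matrix.det_updateCol_add]
        congr 2
        ext (i | i) <;> simp
      map_smul' := fun c F => by
        have h : Sum.elim (C.nabla (c • F)) (fun _ : Unit => inX (c • F)) =
            (MvPolynomial.C c : MvPolynomial (Fin n ⊕ Fin n) R) •
              Sum.elim (C.nabla F) (fun _ : Unit => inX F) := by
          ext1 (i | i) <;> simp [← MvPolynomial.smul_eq_C_mul]
        rw [borderedMatrix_eq C (c • F), borderedMatrix_eq C F, RingHom.id_apply, h,
          Matrix.det_updateCol_smul, MvPolynomial.smul_eq_C_mul] }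

/-- The extension operation `L * F` of a functional and a polynomial. -/
noncomputable def starPoly (C : NablaChoice f) (L : Module.Dual R (MvPolynomial (Fin n) R))
    (F : MvPolynomial (Fin n) R) : MvPolynomial (Fin n) R :=
  extOp C L F

/-- The extension operation `l * L = l.[L]` of two functionals. -/
noncomputable def starFun (C : NablaChoice f) (l L : Module.Dual R (MvPolynomial (Fin n) R)) :
    Module.Dual R (MvPolynomial (Fin n) R) :=
  l ∘ₗ extOp C L

/-- `δ_f = ∑ (deg f_i - 1)`, an integer. -/
noncomputable def delta (f : Fin n → MvPolynomial (Fin n) R) : ℤ :=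
  ∑ i, (((f i).totalDegree : ℤ) - 1)

/-- `(f(x))_x`: the ideal generated by the polynomials of the system. -/
noncomputable def sysIdeal (f : Fin n → MvPolynomial (Fin n) R) : Ideal (MvPolynomial (Fin n) R) :=
  Ideal.span (Set.range f)

/-- `(f(x))_x^{≤ d}`: the polynomials `∑ i, f_i * g_i` with `deg f_i + deg g_i ≤ d` for all `i`. -/
def boundedIdeal (f : Fin n → MvPolynomial (Fin n) R) (d : ℤ) : Set (MvPolynomial (Fin n) R) :=
  {F | ∃ g : Fin n → MvPolynomial (Fin n) R,
    (∀ i, g i ∈ degLE (Fin n) R (d - (f i).totalDegree)) ∧ F = ∑ i, f i * g i}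

/-- `(f(x))_x ∩ R[x^{≤ d}]`. -/
def truncIdeal (f : Fin n → MvPolynomial (Fin n) R) (d : ℤ) : Set (MvPolynomial (Fin n) R) :=
  {F | F ∈ sysIdeal f ∧ F ∈ degLE (Fin n) R d}

/-- The functional `L` annuls the set `S`. -/
def Annuls (L : Module.Dual R (MvPolynomial (Fin n) R)) (S : Set (MvPolynomial (Fin n) R)) : Prop :=
  ∀ F ∈ S, L F = 0

/-- The functionals `L` and `M` are equal in `R[x^{≤ d}]`. -/
def EqUpTo (d : ℤ) (L M : Module.Dual R (MvPolynomial (Fin n) R)) : Prop :=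
  ∀ F ∈ degLE (Fin n) R d, L F = M F

end

end RootFunctional

/-!
Put `u = (x_1 - y_1, …, x_n - y_n)` and let `D_F(x, y)` be the determinant that defines `L * F`. As
`u` times the row block `(∇f, ∇F)` is `(f(x) - f(y), F(x) - F(y))`, the last row `(f(x), F(x))` of
the matrix may be replaced by `(f(y), F(y))`. With `x` in the last row, the expansion along it gives
`E' * F ≡ F · (E' * 1)` modulo the ideal. With `y` in it, it gives the degree of `E' * F`: the term
`F(y) det ∇f` has degree at most `δ_f` in `x`, and `E'(y_*)` kills the monomials `x^α` with
`|α| ≥ deg F - ε` in the terms `f_i(y) g(x, y)`.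

The crucial point is the dependence of `D_F` on the difference derivatives (`det_diffMatrix_sub_mem`).
Two difference derivatives of one polynomial differ by a relation between the `x_j - y_j`, which is a
combination of Koszul relations, of the expected degree (`exists_koszul_sub`). With a Koszul relation
as one of its columns, the determinant expands into products `φ_m(y) φ_m'(x) g(x, y)` with distinct
`φ_m`, `φ_m'` among `f_1, …, f_n, F`, whose degree is at most `δ_f + deg F`
(`det_updateCol_koszul_eq_sum`, `det_updateCol_mem_of_relation`). This has two consequences.

* Modulo the ideal, `E' * 1` does not depend on the choice (`starPoly_one_sub_starPoly_one_mem`), so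
  that `E' * F ≡ F` for every choice (`sub_starPoly_mem_sysIdeal`).
* The exchange of `x` and `y` in `D_F` only amounts to another choice. Hence `E' * L` and `L * E'`
  agree on all `F` of so small a degree that one of `E'`, `L` kills each of the products above
  (`starFun_comm`).

The statements on `l * E'` and `L * E'` follow from the first part of the theorem, and commutativity
carries them over to `E' * l` and `E' * L`.
-/

namespace RootFunctional

open MvPolynomial

/-! ### Polynomials of bounded total degree -/

section Degree

variable {σ τ R : Type*} [CommRing R]

theorem mem_degLE {d : ℤ} {G : MvPolynomial σ R} :
    G ∈ degLE σ R d ↔ ∀ m ∈ G.support, (m.degree : ℤ) ≤ d := by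
  rw [degLE, mem_restrictSupport_iff]
  rfl

theorem degLE_mono {a b : ℤ} (h : a ≤ b) : degLE σ R a ≤ degLE σ R b :=
  restrictSupport_mono R fun _ hm => le_trans hm h

theorem monomial_mem_degLE {d : ℤ} {m : σ →₀ ℕ} (h : (m.degree : ℤ) ≤ d) (c : R) :
    monomial m c ∈ degLE σ R d :=
  (monomial_mem_restrictSupport R).2 (Or.inl h)

theorem eq_zero_of_mem_degLE {d : ℤ} (hd : d < 0) {G : MvPolynomial σ R} (hG : G ∈ degLE σ R d) :
    G = 0 := by
  rw [← support_eq_empty, Finset.eq_empty_iff_forall_notMem]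
  intro m hm
  have := mem_degLE.1 hG m hm
  omega

theorem mul_mem_degLE {a b : ℤ} {F G : MvPolynomial σ R} (hF : F ∈ degLE σ R a)
    (hG : G ∈ degLE σ R b) : F * G ∈ degLE σ R (a + b) := by
  classical
  rw [mem_degLE] at *
  intro m hm
  obtain ⟨p, hp, q, hq, rfl⟩ := Finset.mem_add.1 (support_mul F G hm)
  have := hF p hp
  have := hG q hq
  rw [map_add]
  push_cast
  omega

theorem C_mem_degLE (c : R) : (C c : MvPolynomial σ R) ∈ degLE σ R 0 :=
  monomial_mem_degLE (by simp) c

theorem one_mem_degLE : (1 : MvPolynomial σ R) ∈ degLE σ R 0 := by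
  simpa using C_mem_degLE (σ := σ) (1 : R)

theorem X_mem_degLE (i : σ) : (X i : MvPolynomial σ R) ∈ degLE σ R 1 :=
  monomial_mem_degLE (by simp) 1

theorem prod_mem_degLE {κ : Type*} (s : Finset κ) (F : κ → MvPolynomial σ R) (a : κ → ℤ)
    (h : ∀ i ∈ s, F i ∈ degLE σ R (a i)) : ∏ i ∈ s, F i ∈ degLE σ R (∑ i ∈ s, a i) := by
  classical
  induction s using Finset.induction_on with
  | empty => simpa using one_mem_degLE
  | insert i s hi ih =>
    rw [Finset.prod_insert hi, Finset.sum_insert hi]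
    exact mul_mem_degLE (h i (Finset.mem_insert_self i s))
      (ih fun j hj => h j (Finset.mem_insert_of_mem hj))

theorem pow_mem_degLE {F : MvPolynomial σ R} (hF : F ∈ degLE σ R 1) (k : ℕ) :
    F ^ k ∈ degLE σ R k := by
  simpa using prod_mem_degLE (Finset.range k) (fun _ => F) (fun _ => 1) fun _ _ => hF

theorem mem_degLE_totalDegree (F : MvPolynomial σ R) : F ∈ degLE σ R F.totalDegree := by
  rw [mem_degLE]
  intro m hm
  have := le_totalDegree hm
  exact_mod_cast this

theorem totalDegree_le_of_mem_degLE {d : ℤ} {F : MvPolynomial σ R} (hF : F ∈ degLE σ R d)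
    (h0 : F ≠ 0) : (F.totalDegree : ℤ) ≤ d := by
  have hd : 0 ≤ d := by
    by_contra hd
    exact h0 (eq_zero_of_mem_degLE (by omega) hF)
  lift d to ℕ using hd
  rw [mem_degLE] at hF
  have : F.totalDegree ≤ d := by
    rw [totalDegree]
    refine Finset.sup_le fun m hm => ?_
    have := hF m hm
    exact_mod_cast this
  exact_mod_cast this

theorem map_mem_degLE (φ : MvPolynomial σ R →ₐ[R] MvPolynomial τ R)
    (hφ : ∀ i, φ (X i) ∈ degLE τ R 1) {d : ℤ} {F : MvPolynomial σ R} (hF : F ∈ degLE σ R d) :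
    φ F ∈ degLE τ R d := by
  rw [F.as_sum, map_sum]
  refine Submodule.sum_mem _ fun m hm => ?_
  have h1 : φ (monomial m (coeff m F)) = C (coeff m F) * ∏ i ∈ m.support, φ (X i) ^ m i := by
    rw [monomial_eq, map_mul, Finsupp.prod, map_prod]
    congr 1
    · exact φ.commutes _
    · simp
  rw [h1]
  refine degLE_mono ?_ (mul_mem_degLE (C_mem_degLE _)
    (prod_mem_degLE _ _ (fun i => (m i : ℤ)) fun i _ => pow_mem_degLE (hφ i) _))
  have := mem_degLE.1 hF m hm
  rw [Finsupp.degree_apply] at this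
  push_cast at this
  omega

theorem rename_mem_degLE (g : σ → τ) {d : ℤ} {F : MvPolynomial σ R} (hF : F ∈ degLE σ R d) :
    rename g F ∈ degLE τ R d :=
  map_mem_degLE _ (fun i => by rw [rename_X]; exact X_mem_degLE _) hF

/-- A determinant is bounded in degree by any degrees of the rows and columns that bound the degrees
of the entries. The degrees of the rows and columns may be negative. -/
theorem det_mem_degLE {ι : Type*} [Fintype ι] [DecidableEq ι] (M : Matrix ι ι (MvPolynomial σ R))
    (a b : ι → ℤ) (h : ∀ i j, M i j ∈ degLE σ R (a i + b j)) :
    M.det ∈ degLE σ R (∑ i, a i + ∑ i, b i) := by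
  rw [Matrix.det_apply]
  refine Submodule.sum_mem _ fun p _ => ?_
  rw [Units.smul_def, zsmul_eq_mul]
  have h1 := prod_mem_degLE Finset.univ (fun i => M (p i) i) (fun i => a (p i) + b i)
    fun i _ => h (p i) i
  rw [Finset.sum_add_distrib, Equiv.sum_comp p a] at h1
  rw [← zsmul_eq_mul]
  exact zsmul_mem h1 _

end Degree

/-! ### Determinants -/

section Determinant

open Matrix

variable {ι A : Type*} [Fintype ι] [DecidableEq ι] [CommRing A]

theorem det_updateRow_single_eq (M : Matrix ι ι A) (j c : ι) :
    (M.updateRow j (Pi.single c 1)).det = (M.updateCol c (Pi.single j 1)).det := by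
  rw [← adjugate_apply, ← det_transpose (M.updateCol c (Pi.single j 1)), ← updateRow_transpose,
    ← adjugate_apply, ← adjugate_transpose, transpose_apply]

theorem det_eq_sum_mul_det_updateRow (M : Matrix ι ι A) (r : ι) :
    M.det = ∑ c, M r c * (M.updateRow r (Pi.single c 1)).det := by
  rw [det_eq_sum_mul_adjugate_row M r]
  simp only [adjugate_apply]

/-- The determinant of `M` with the Koszul relation `u j • e_k - u k • e_j` as column `c`: it is that
of `M` with `e_k` as column `c` and then the row `j` replaced by `u ᵥ* M`, with the entry `0` in the
column `c`. -/
theorem det_updateCol_koszul (M : Matrix ι ι A) (u : ι → A) (j k c : ι) :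
    u j * (M.updateCol c (Pi.single k 1)).det - u k * (M.updateCol c (Pi.single j 1)).det =
      ((M.updateCol c (Pi.single k 1)).updateRow j (Function.update (u ᵥ* M) c 0)).det := by
  have h1 := det_updateRow_sum (M.updateCol c (Pi.single k 1)) j u
  have h2 : ∑ l, u l • (M.updateCol c (Pi.single k 1)) l =
      Function.update (u ᵥ* M) c 0 + u k • Pi.single c 1 := by
    ext m
    rw [Finset.sum_apply]
    by_cases hm : m = c
    · subst hm
      simp [Pi.single_apply]
    · simp [hm, vecMul, dotProduct, updateCol_ne]
  rw [h2, det_updateRow_add, det_updateRow_smul, det_updateRow_single_eq, updateCol_idem] at h1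
  rw [smul_eq_mul] at h1
  rw [← h1]
  ring

/-- The expansion of `det_updateCol_koszul` along the rows `j` and `r`. Row `k` of the remaining
matrices is set to `e_c`, which leaves the determinant unchanged and makes its degree visible. -/
theorem det_updateCol_koszul_eq_sum (M : Matrix ι ι A) (u : ι → A) {j k r : ι} (c : ι)
    (hjk : j ≠ k) (hjr : j ≠ r) (hkr : k ≠ r) :
    u j * (M.updateCol c (Pi.single k 1)).det - u k * (M.updateCol c (Pi.single j 1)).det =
      ∑ m ∈ Finset.univ.erase c, ∑ m' ∈ (Finset.univ.erase c).erase m,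
        (u ᵥ* M) m * M r m' * ((((M.updateCol c (Pi.single k 1)).updateRow j
          (Pi.single m 1)).updateRow r (Pi.single m' 1)).updateRow k (Pi.single c 1)).det := by
  rw [det_updateCol_koszul M u j k c, det_eq_sum_mul_det_updateRow _ j,
    ← Finset.sum_erase_add _ _ (Finset.mem_univ c)]
  simp only [updateRow_self, Function.update_self, zero_mul, add_zero, updateRow_idem]
  refine Finset.sum_congr rfl fun m hm => ?_
  have hmc := Finset.ne_of_mem_erase hm
  rw [Function.update_of_ne hmc, det_eq_sum_mul_det_updateRow _ r,
    ← Finset.sum_erase_add _ _ (Finset.mem_univ c), ← Finset.sum_erase_add _ _ hm]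
  have hz : ((((M.updateCol c (Pi.single k 1)).updateRow j
      (Pi.single m 1)).updateRow r (Pi.single m 1))).det = 0 :=
    det_zero_of_row_eq hjr (by rw [updateRow_self, updateRow_ne hjr, updateRow_self])
  rw [hz, mul_zero, add_zero, updateRow_ne hjr.symm, updateCol_self, Pi.single_eq_of_ne hkr.symm,
    zero_mul, add_zero, Finset.mul_sum]
  refine Finset.sum_congr rfl fun m' hm' => ?_
  have hmc' := Finset.ne_of_mem_erase (Finset.mem_of_mem_erase hm')
  rw [updateCol_ne hmc', det_updateRow_single_eq _ k c, mul_assoc]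
  congr 3
  -- the column `c` of the matrix on the left is already `e_k`
  ext a b
  by_cases hb : b = c
  · subst hb
    by_cases har : a = r
    · simp [updateRow_apply, har, hkr.symm, hmc'.symm]
    · by_cases haj : a = j <;>
        simp [updateRow_apply, haj, hjk, hjr, hmc.symm, har]
  · rw [updateCol_ne hb]

end Determinant

/-! ### Koszul relations with degree bounds -/

section Koszul

variable {σ κ R : Type*} [CommRing R]

/-- A polynomial each monomial of which contains one of the variables `X (v j)`, `j ∈ S`, is a
combination of them with coefficients of degree one less. -/
theorem exists_eq_sum_X_mul (v : κ → σ) (S : Finset κ) {d : ℤ} {G : MvPolynomial σ R}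
    (hd : G ∈ degLE σ R d) (hG : ∀ m ∈ G.support, ∃ j ∈ S, m (v j) ≠ 0) :
    ∃ t : κ → MvPolynomial σ R, (∀ j, t j ∈ degLE σ R (d - 1)) ∧ G = ∑ j ∈ S, X (v j) * t j := by
  classical
  cases isEmpty_or_nonempty κ
  · refine ⟨0, fun _ => Submodule.zero_mem _, ?_⟩
    rw [Finset.eq_empty_of_isEmpty S, Finset.sum_empty, ← support_eq_empty,
      Finset.eq_empty_iff_forall_notMem]
    exact fun m hm => isEmptyElim (hG m hm).choose
  choose! φ hφS hφ using hG
  refine ⟨fun j => ∑ m ∈ G.support with φ m = j,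
    monomial (m - Finsupp.single (v j) 1) (coeff m G), fun j => ?_, ?_⟩
  · refine Submodule.sum_mem _ fun m hm => monomial_mem_degLE ?_ _
    obtain ⟨hmG, rfl⟩ := Finset.mem_filter.1 hm
    have h1 : Finsupp.single (v (φ m)) 1 ≤ m :=
      Finsupp.single_le_iff.2 (Nat.one_le_iff_ne_zero.2 (hφ m hmG))
    have h2 := congrArg Finsupp.degree (tsub_add_cancel_of_le h1)
    rw [map_add, Finsupp.degree_single] at h2
    have := mem_degLE.1 hd m hmG
    omega
  · conv_lhs => rw [G.as_sum, ← Finset.sum_fiberwise_of_maps_to hφS]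
    refine Finset.sum_congr rfl fun j _ => ?_
    rw [Finset.mul_sum]
    refine Finset.sum_congr rfl fun m hm => ?_
    obtain ⟨hmG, rfl⟩ := Finset.mem_filter.1 hm
    have h1 : Finsupp.single (v (φ m)) 1 ≤ m :=
      Finsupp.single_le_iff.2 (Nat.one_le_iff_ne_zero.2 (hφ m hmG))
    rw [X, monomial_mul, one_mul, add_tsub_cancel_of_le h1]

/-- The relations between distinct variables are generated by the Koszul relations, with the
expected degree bounds. -/
theorem exists_koszul_X (v : κ → σ) (hv : Function.Injective v) (S : Finset κ) {d : ℤ}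
    (w : κ → MvPolynomial σ R) (hd : ∀ j, w j ∈ degLE σ R d)
    (hw : ∑ j ∈ S, X (v j) * w j = 0) :
    ∃ s : κ → κ → MvPolynomial σ R, (∀ j k, s j k ∈ degLE σ R (d - 1)) ∧
      ∀ k ∈ S, w k = ∑ j ∈ S, X (v j) * (s j k - s k j) := by
  classical
  induction S using Finset.induction_on generalizing w with
  | empty => exact ⟨0, fun _ _ => Submodule.zero_mem _, by simp⟩
  | insert a S ha ih =>
    have h1 : ∀ m ∈ (w a).support, ∃ j ∈ S, m (v j) ≠ 0 := by
      intro m hm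
      by_contra! hcon
      rw [mem_support_iff] at hm
      apply hm
      have h := congrArg (coeff (m + Finsupp.single (v a) 1)) hw
      rw [Finset.sum_insert ha, coeff_add, mul_comm, coeff_mul_X, coeff_sum, coeff_zero,
        Finset.sum_eq_zero, add_zero] at h
      · exact h
      · intro j hj
        have hja : v a ≠ v j := fun h => ha (hv h ▸ hj)
        rw [coeff_X_mul', if_neg]
        simp [hcon j hj, hja]
    obtain ⟨t, htd, ht⟩ := exists_eq_sum_X_mul v S (hd a) h1
    -- the relation `w` is reduced modulo `t j • (X_j e_a - X_a e_j)` to one on `S`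
    obtain ⟨s, hsd, hs⟩ := ih (fun j => w j + X (v a) * t j)
      (fun j => Submodule.add_mem _ (hd j)
        (degLE_mono (by omega) (mul_mem_degLE (X_mem_degLE (v a)) (htd j)))) (by
        rw [← hw, Finset.sum_insert ha, ht, Finset.mul_sum, ← Finset.sum_add_distrib]
        exact Finset.sum_congr rfl fun j _ => by ring)
    refine ⟨fun j k => if j = a then 0 else if k = a then t j else s j k, fun j k => ?_,
      fun k hk => ?_⟩
    · dsimp only
      split_ifs
      exacts [Submodule.zero_mem _, htd j, hsd j k]
    · rw [Finset.sum_insert ha]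
      by_cases hka : k = a
      · subst hka
        conv_lhs => rw [ht]
        beta_reduce
        rw [if_pos rfl, sub_self, mul_zero, zero_add]
        refine Finset.sum_congr rfl fun j hj => ?_
        have : j ≠ k := fun h => ha (h ▸ hj)
        simp [this]
      · have h2 := hs k (Finset.mem_of_mem_insert_of_ne hk hka)
        rw [eq_comm, ← sub_eq_iff_eq_add] at h2
        rw [← h2]
        beta_reduce
        rw [if_pos rfl, if_neg hka, if_pos rfl, zero_sub, mul_neg, ← sub_eq_neg_add]
        congr 1
        refine Finset.sum_congr rfl fun j hj => ?_
        have : j ≠ a := fun h => ha (h ▸ hj)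
        simp [this, hka]

/-- The relations between the differences `x_j - y_j` are generated by the Koszul relations, with
the expected degree bounds. -/
theorem exists_koszul_sub [Fintype κ] {d : ℤ} (w : κ → MvPolynomial (κ ⊕ κ) R)
    (hd : ∀ j, w j ∈ degLE (κ ⊕ κ) R d)
    (hw : ∑ j, (X (Sum.inl j) - X (Sum.inr j)) * w j = 0) :
    ∃ s : κ → κ → MvPolynomial (κ ⊕ κ) R, (∀ j k, s j k ∈ degLE (κ ⊕ κ) R (d - 1)) ∧
      ∀ k, w k = ∑ j, (X (Sum.inl j) - X (Sum.inr j)) * (s j k - s k j) := by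
  -- the coordinate change `x ↦ x + y` turns the differences into variables
  let α : MvPolynomial (κ ⊕ κ) R →ₐ[R] MvPolynomial (κ ⊕ κ) R :=
    aeval (Sum.elim (fun j => X (Sum.inl j) + X (Sum.inr j)) fun j => X (Sum.inr j))
  let β : MvPolynomial (κ ⊕ κ) R →ₐ[R] MvPolynomial (κ ⊕ κ) R :=
    aeval (Sum.elim (fun j => X (Sum.inl j) - X (Sum.inr j)) fun j => X (Sum.inr j))
  have hα : ∀ i, α (X i) ∈ degLE (κ ⊕ κ) R 1 := by
    rintro (i | i)
    · simpa [α] using Submodule.add_mem _ (X_mem_degLE _) (X_mem_degLE _)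
    · simpa [α] using X_mem_degLE _
  have hβ : ∀ i, β (X i) ∈ degLE (κ ⊕ κ) R 1 := by
    rintro (i | i)
    · simpa [β] using Submodule.sub_mem _ (X_mem_degLE _) (X_mem_degLE _)
    · simpa [β] using X_mem_degLE _
  have hβα : ∀ G, β (α G) = G := by
    intro G
    have : β.comp α = AlgHom.id R _ := by
      ext (i | i) <;> simp [α, β]
    exact DFunLike.congr_fun this G
  obtain ⟨s, hsd, hs⟩ := exists_koszul_X (Sum.inl : κ → κ ⊕ κ) Sum.inl_injective Finset.univ
    (fun j => α (w j)) (fun j => map_mem_degLE α hα (hd j)) (by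
      rw [← map_zero α, ← hw, map_sum]
      refine Finset.sum_congr rfl fun j _ => ?_
      simp [α])
  refine ⟨fun j k => β (s j k), fun j k => map_mem_degLE β hβ (hsd j k), fun k => ?_⟩
  have h := congrArg β (hs k (Finset.mem_univ k))
  rw [hβα, map_sum] at h
  rw [h]
  refine Finset.sum_congr rfl fun j _ => ?_
  simp [β]

end Koszul

/-! ### Partial application of a functional -/

section ApplyY

variable {R : Type*} [CommRing R] {n : ℕ} (L : Module.Dual R (MvPolynomial (Fin n) R))

theorem monomial_eq_inX_mul_inY (m : Fin n ⊕ Fin n →₀ ℕ) (c : R) :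
    (monomial m c : MvPolynomial (Fin n ⊕ Fin n) R) =
      inX (monomial (Finsupp.sumFinsuppEquivProdFinsupp m).1 c) *
        inY (monomial (Finsupp.sumFinsuppEquivProdFinsupp m).2 1) := by
  have h : m = Finsupp.mapDomain Sum.inl (Finsupp.sumFinsuppEquivProdFinsupp m).1 +
      Finsupp.mapDomain Sum.inr (Finsupp.sumFinsuppEquivProdFinsupp m).2 := by
    ext i
    rcases i with i | i
    · rw [Finsupp.add_apply, Finsupp.mapDomain_apply Sum.inl_injective,
        Finsupp.mapDomain_of_notMem_range _ _ (by simp), add_zero]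
      rfl
    · rw [Finsupp.add_apply, Finsupp.mapDomain_apply Sum.inr_injective,
        Finsupp.mapDomain_of_notMem_range _ _ (by simp), zero_add]
      rfl
  rw [inX, inY, rename_monomial, rename_monomial, monomial_mul, mul_one, ← h]

theorem degree_eq_degree_fst_add_degree_snd (m : Fin n ⊕ Fin n →₀ ℕ) :
    m.degree = (Finsupp.sumFinsuppEquivProdFinsupp m).1.degree +
      (Finsupp.sumFinsuppEquivProdFinsupp m).2.degree := by
  simp [Finsupp.degree_eq_sum]

/-- Linear maps out of `R[x, y]` are determined by their values on the products `P(x) Q(y)`. -/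
theorem linearMap_ext_inX_mul_inY {M : Type*} [AddCommMonoid M] [Module R M]
    {Φ Ψ : MvPolynomial (Fin n ⊕ Fin n) R →ₗ[R] M}
    (h : ∀ P Q, Φ (inX P * inY Q) = Ψ (inX P * inY Q)) : Φ = Ψ := by
  refine (basisMonomials (Fin n ⊕ Fin n) R).ext fun m => ?_
  rw [coe_basisMonomials]
  beta_reduce
  rw [monomial_eq_inX_mul_inY]
  exact h _ _

theorem applyY_monomial (m : Fin n ⊕ Fin n →₀ ℕ) (c : R) :
    applyY L (monomial m c) = monomial (Finsupp.sumFinsuppEquivProdFinsupp m).1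
      (c * L (monomial (Finsupp.sumFinsuppEquivProdFinsupp m).2 1)) := by
  have h := (basisMonomials (Fin n ⊕ Fin n) R).constr_basis R (fun m =>
    monomial (Finsupp.sumFinsuppEquivProdFinsupp m).1
      (L (monomial (Finsupp.sumFinsuppEquivProdFinsupp m).2 1))) m
  rw [coe_basisMonomials] at h
  rw [← mul_one c, ← smul_eq_mul, ← smul_monomial, map_smul, applyY, h, smul_monomial]
  simp

theorem applyY_inX_mul_inY (P Q : MvPolynomial (Fin n) R) :
    applyY L (inX P * inY Q) = L Q • P := by
  rw [P.as_sum, Q.as_sum]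
  simp only [map_sum, Finset.sum_mul_sum, Finset.sum_smul, Finset.smul_sum]
  refine Finset.sum_congr rfl fun p _ => Finset.sum_congr rfl fun q _ => ?_
  have h1 : (monomial q (coeff q Q) : MvPolynomial (Fin n) R) = coeff q Q • monomial q 1 := by
    rw [smul_monomial, smul_eq_mul, mul_one]
  have h2 := monomial_eq_inX_mul_inY (Finsupp.sumFinsuppEquivProdFinsupp.symm (p, q)) (coeff p P)
  have h3 := applyY_monomial L (Finsupp.sumFinsuppEquivProdFinsupp.symm (p, q)) (coeff p P)
  rw [h2, Equiv.apply_symm_apply] at h3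
  rw [h1, map_smul, map_smul, mul_smul_comm, map_smul, h3, smul_monomial, smul_monomial,
    smul_eq_mul, smul_eq_mul, smul_eq_mul, mul_assoc, mul_comm (L _)]

theorem applyY_inX_mul (P : MvPolynomial (Fin n) R) (G : MvPolynomial (Fin n ⊕ Fin n) R) :
    applyY L (inX P * G) = P * applyY L G := by
  have : applyY L ∘ₗ LinearMap.mulLeft R (inX P) = LinearMap.mulLeft R P ∘ₗ applyY L := by
    refine linearMap_ext_inX_mul_inY fun P' Q => ?_
    simp only [LinearMap.comp_apply, LinearMap.mulLeft_apply]
    rw [← mul_assoc, ← map_mul, applyY_inX_mul_inY, applyY_inX_mul_inY, mul_smul_comm]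
  exact LinearMap.congr_fun this G

/-- Two functionals, one acting on `x` and the other on `y`, may be applied in any order. -/
theorem apply_applyY_comm (A : Module.Dual R (MvPolynomial (Fin n) R))
    (G : MvPolynomial (Fin n ⊕ Fin n) R) :
    A (applyY L G) = L (applyY A (rename Sum.swap G)) := by
  have : A ∘ₗ applyY L = L ∘ₗ applyY A ∘ₗ (rename Sum.swap).toLinearMap := by
    refine linearMap_ext_inX_mul_inY fun P Q => ?_
    have h : rename Sum.swap (inX P * inY Q) = inX Q * inY P := by
      rw [map_mul, inX, inY, rename_rename, rename_rename, mul_comm]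
      rfl
    simp only [LinearMap.comp_apply, AlgHom.toLinearMap_apply]
    rw [h, applyY_inX_mul_inY, applyY_inX_mul_inY]
    simp [mul_comm]
  exact LinearMap.congr_fun this G

/-- If `L` annuls `Q • R[x^{≤ t}]`, then `L(y_*)` lowers the degree of the multiples of `Q(y)`: what
is left of a monomial `x^α y^β` has `|β| > t`. -/
theorem applyY_inY_mul_mem_degLE {Q : MvPolynomial (Fin n) R} {t e : ℤ}
    (hQ : ∀ P ∈ degLE (Fin n) R t, L (Q * P) = 0) {G : MvPolynomial (Fin n ⊕ Fin n) R}
    (hG : G ∈ degLE (Fin n ⊕ Fin n) R e) : applyY L (inY Q * G) ∈ degLE (Fin n) R (e - t - 1) := by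
  rw [G.as_sum, Finset.mul_sum, map_sum]
  refine Submodule.sum_mem _ fun m hm => ?_
  rw [monomial_eq_inX_mul_inY, mul_left_comm, ← map_mul, applyY_inX_mul_inY]
  have h1 := mem_degLE.1 hG m hm
  rw [degree_eq_degree_fst_add_degree_snd] at h1
  push_cast at h1
  by_cases h : ((Finsupp.sumFinsuppEquivProdFinsupp m).2.degree : ℤ) ≤ t
  · rw [hQ _ (monomial_mem_degLE h 1), zero_smul]
    exact Submodule.zero_mem _
  · exact Submodule.smul_mem _ _ (monomial_mem_degLE (by omega) _)

theorem applyY_inY_mul_mem_degLE_self (Q : MvPolynomial (Fin n) R) {e : ℤ}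
    {G : MvPolynomial (Fin n ⊕ Fin n) R} (hG : G ∈ degLE (Fin n ⊕ Fin n) R e) :
    applyY L (inY Q * G) ∈ degLE (Fin n) R e := by
  have h := applyY_inY_mul_mem_degLE L (Q := Q) (t := -1) (fun P hP => by
    rw [eq_zero_of_mem_degLE (by omega) hP, mul_zero, map_zero]) hG
  exact degLE_mono (by omega) h

end ApplyY

/-! ### Determinants of difference derivatives -/

section DiffMatrix

open Matrix

variable {R : Type*} [CommRing R] {n : ℕ}

/-- The matrix with columns `(V c, φ c (x))`. With `φ = (f, F)` and `V = (∇f, ∇F)` it is the matrix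
of the extension operation; `F` is treated on the same footing as the polynomials of the system. -/
noncomputable def diffMatrix (φ : Fin n ⊕ Unit → MvPolynomial (Fin n) R)
    (V : Fin n ⊕ Unit → Fin n → MvPolynomial (Fin n ⊕ Fin n) R) :
    Matrix (Fin n ⊕ Unit) (Fin n ⊕ Unit) (MvPolynomial (Fin n ⊕ Fin n) R) :=
  Matrix.of fun l c => Sum.elim (V c) (fun _ => inX (φ c)) l

/-- The row vector `(x - y, -1)`. -/
noncomputable def diffVec : Fin n ⊕ Unit → MvPolynomial (Fin n ⊕ Fin n) R :=
  Sum.elim (fun j => X (Sum.inl j) - X (Sum.inr j)) fun _ => -1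

variable {φ : Fin n ⊕ Unit → MvPolynomial (Fin n) R}
  {V V' : Fin n ⊕ Unit → Fin n → MvPolynomial (Fin n ⊕ Fin n) R}

theorem diffVec_vecMul (hV : ∀ c, IsDiffDeriv (φ c) (V c)) :
    diffVec ᵥ* diffMatrix φ V = fun c => -inY (φ c) := by
  ext1 c
  have h := (hV c).1
  simp only [vecMul, dotProduct, Fintype.sum_sum_type, diffVec, diffMatrix, Sum.elim_inl,
    Sum.elim_inr, of_apply, Finset.univ_unique, Finset.sum_singleton]
  rw [← h]
  ring

/-- The last row `φ(x)` may be replaced by `φ(y)`. -/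
theorem det_diffMatrix_eq_det_updateRow (hV : ∀ c, IsDiffDeriv (φ c) (V c)) :
    (diffMatrix φ V).det =
      ((diffMatrix φ V).updateRow (Sum.inr ()) fun c => inY (φ c)).det := by
  have h := det_updateRow_sum (diffMatrix φ V) (Sum.inr ()) (-diffVec)
  have h1 : ∑ l, (-diffVec : Fin n ⊕ Unit → MvPolynomial (Fin n ⊕ Fin n) R) l •
      diffMatrix φ V l = fun c => inY (φ c) := by
    ext1 c
    have := congrFun (diffVec_vecMul hV) c
    simp only [vecMul, dotProduct] at this
    rw [Finset.sum_apply, ← neg_neg (inY (φ c)), ← this, ← Finset.sum_neg_distrib]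
    refine Finset.sum_congr rfl fun l _ => ?_
    simp
  rw [h1] at h
  rw [h]
  simp [diffVec]

theorem det_diffMatrix_eq_sum_inX :
    (diffMatrix φ V).det = ∑ c, inX (φ c) *
      ((diffMatrix φ V).updateRow (Sum.inr ()) (Pi.single c 1)).det := by
  rw [det_eq_sum_mul_det_updateRow _ (Sum.inr ())]
  rfl

theorem det_diffMatrix_eq_sum_inY (hV : ∀ c, IsDiffDeriv (φ c) (V c)) :
    (diffMatrix φ V).det = ∑ c, inY (φ c) *
      ((diffMatrix φ V).updateRow (Sum.inr ()) (Pi.single c 1)).det := by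
  rw [det_diffMatrix_eq_det_updateRow hV, det_eq_sum_mul_det_updateRow _ (Sum.inr ())]
  simp only [updateRow_self, updateRow_idem]

theorem cofactor_diffMatrix_mem_degLE (hV : ∀ c, IsDiffDeriv (φ c) (V c)) (c : Fin n ⊕ Unit) :
    ((diffMatrix φ V).updateRow (Sum.inr ()) (Pi.single c 1)).det ∈ degLE (Fin n ⊕ Fin n) R
      (∑ i, (((φ i).totalDegree : ℤ) - 1) + 1 - (φ c).totalDegree) := by
  -- the row `e_c` is given the negative degree that makes up for the degree of the column `c`
  have h := det_mem_degLE ((diffMatrix φ V).updateRow (Sum.inr ()) (Pi.single c 1))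
    (Sum.elim (fun _ => 0) fun _ => 1 - ((φ c).totalDegree : ℤ))
    (fun i => ((φ i).totalDegree : ℤ) - 1) (by
      rintro (j | j) i
      · simpa [diffMatrix] using (hV i).2 j
      · by_cases hi : i = c
        · subst hi
          simpa using one_mem_degLE
        · simp [hi])
  refine degLE_mono (le_of_eq ?_) h
  simp
  ring

/-- Let `J` contain the products `φ_m(y) φ_m'(x) g`, `m ≠ m'`, of degree at most `∑ (deg φ_c - 1) + 1`.
Then `J` contains the determinant in which a difference derivative has been replaced by a column `w`
orthogonal to `x - y`. -/
theorem det_updateCol_mem_of_relation {J : AddSubgroup (MvPolynomial (Fin n ⊕ Fin n) R)}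
    (hJ : ∀ m m', m ≠ m' → ∀ g ∈ degLE (Fin n ⊕ Fin n) R
      (∑ i, (((φ i).totalDegree : ℤ) - 1) + 1 - (φ m).totalDegree - (φ m').totalDegree),
      inY (φ m) * inX (φ m') * g ∈ J)
    (hV : ∀ c, IsDiffDeriv (φ c) (V c)) (c : Fin n ⊕ Unit)
    {w : Fin n → MvPolynomial (Fin n ⊕ Fin n) R}
    (hwd : ∀ j, w j ∈ degLE (Fin n ⊕ Fin n) R ((φ c).totalDegree - 1))
    (hw : ∑ j, (X (Sum.inl j) - X (Sum.inr j)) * w j = 0) :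
    ((diffMatrix φ V).updateCol c (Sum.elim w 0)).det ∈ J := by
  obtain ⟨s, hsd, hs⟩ := exists_koszul_sub w hwd hw
  set M := diffMatrix φ V with hM
  let D : Fin n → MvPolynomial (Fin n ⊕ Fin n) R :=
    fun k => (M.updateCol c (Pi.single (Sum.inl k) 1)).det
  have h1 : (M.updateCol c (Sum.elim w 0)).det =
      ∑ j, ∑ k, s j k * (diffVec (Sum.inl j) * D k - diffVec (Sum.inl k) * D j) := by
    have h2 : (M.updateCol c (Sum.elim w 0)).det = ∑ k, w k * D k := by
      rw [det_eq_sum_mul_adjugate_col _ c, Fintype.sum_sum_type]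
      simp only [updateCol_self, adjugate_apply, det_updateRow_single_eq, updateCol_idem,
        Sum.elim_inl, Sum.elim_inr, Pi.zero_apply, zero_mul, Finset.sum_const_zero, add_zero]
      rfl
    have h3 : ∑ k, w k * D k = ∑ k, ∑ j, s j k * (diffVec (Sum.inl j) * D k) -
        ∑ k, ∑ j, s k j * (diffVec (Sum.inl j) * D k) := by
      rw [← Finset.sum_sub_distrib]
      refine Finset.sum_congr rfl fun k _ => ?_
      rw [hs k, Finset.sum_mul, ← Finset.sum_sub_distrib]
      refine Finset.sum_congr rfl fun j _ => ?_
      simp only [diffVec, Sum.elim_inl]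
      ring
    rw [h2, h3, Finset.sum_comm, ← Finset.sum_sub_distrib]
    refine Finset.sum_congr rfl fun j _ => ?_
    rw [← Finset.sum_sub_distrib]
    refine Finset.sum_congr rfl fun k _ => by ring
  rw [h1]
  refine sum_mem fun j _ => sum_mem fun k _ => ?_
  by_cases hjk : j = k
  · subst hjk
    rw [sub_self, mul_zero]
    exact zero_mem J
  rw [det_updateCol_koszul_eq_sum M diffVec c (r := Sum.inr ())
    (fun h => hjk (Sum.inl_injective h)) Sum.inl_ne_inr Sum.inl_ne_inr, Finset.mul_sum]
  refine sum_mem fun m hm => ?_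
  rw [Finset.mul_sum]
  refine sum_mem fun m' hm' => ?_
  have hmc := Finset.ne_of_mem_erase hm
  have hmc' := Finset.ne_of_mem_erase (Finset.mem_of_mem_erase hm')
  have hmm' := Finset.ne_of_mem_erase hm'
  set N := (((M.updateCol c (Pi.single (Sum.inl k) 1)).updateRow (Sum.inl j)
    (Pi.single m 1)).updateRow (Sum.inr ()) (Pi.single m' 1)).updateRow (Sum.inl k)
    (Pi.single c 1) with hN
  have hNd := det_mem_degLE N
    (Sum.elim (fun i => if i = j then 1 - ((φ m).totalDegree : ℤ) else
      if i = k then 1 - ((φ c).totalDegree : ℤ) else 0) fun _ => 1 - ((φ m').totalDegree : ℤ))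
    (fun i => ((φ i).totalDegree : ℤ) - 1) (by
      have h0 : ∀ (a b : Fin n ⊕ Unit), (Pi.single a 1 : Fin n ⊕ Unit →
          MvPolynomial (Fin n ⊕ Fin n) R) b ∈ degLE (Fin n ⊕ Fin n) R
          (1 - ((φ a).totalDegree : ℤ) + (((φ b).totalDegree : ℤ) - 1)) := by
        intro a b
        by_cases hab : b = a
        · subst hab
          simpa using one_mem_degLE
        · rw [Pi.single_eq_of_ne hab]
          exact Submodule.zero_mem _
      rintro (i | i) b
      · by_cases hij : i = j
        · subst hij
          simpa [hN, hjk, updateRow_apply] using h0 m b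
        · by_cases hik : i = k
          · subst hik
            simpa [hN, hij, updateRow_apply] using h0 c b
          · by_cases hb : b = c
            · subst hb
              simp [hN, hij, hik, updateRow_apply]
            · simpa [hN, hij, hik, hb, updateRow_apply, updateCol_apply, hM, diffMatrix]
                using (hV b).2 i
      · simpa [hN, updateRow_apply] using h0 m' b)
  have hsum : ∑ i, (if i = j then 1 - ((φ m).totalDegree : ℤ) else
      if i = k then 1 - ((φ c).totalDegree : ℤ) else 0) =
      1 - ((φ m).totalDegree : ℤ) + (1 - ((φ c).totalDegree : ℤ)) := by
    rw [Fintype.sum_eq_add j k hjk]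
    · simp [Ne.symm hjk]
    · rintro i ⟨hij, hik⟩
      simp [hij, hik]
  have h4 := hJ m m' hmm'.symm (-(s j k * N.det)) (Submodule.neg_mem _
    (degLE_mono (by
      rw [Fintype.sum_sum_type (f := Sum.elim _ _)]
      simp only [Sum.elim_inl, Sum.elim_inr, hsum, Finset.univ_unique, Finset.sum_singleton]
      linarith) (mul_mem_degLE (hsd j k) hNd)))
  rw [diffVec_vecMul hV]
  convert h4 using 1
  have : M (Sum.inr ()) m' = inX (φ m') := rfl
  rw [this]
  ring

/-- A change of the difference derivatives changes the determinant by a sum of products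
`φ_m(y) φ_m'(x) g`, `m ≠ m'`, of degree at most `∑ (deg φ_c - 1) + 1`. -/
theorem det_diffMatrix_sub_mem {J : AddSubgroup (MvPolynomial (Fin n ⊕ Fin n) R)}
    (hJ : ∀ m m', m ≠ m' → ∀ g ∈ degLE (Fin n ⊕ Fin n) R
      (∑ i, (((φ i).totalDegree : ℤ) - 1) + 1 - (φ m).totalDegree - (φ m').totalDegree),
      inY (φ m) * inX (φ m') * g ∈ J)
    (hV : ∀ c, IsDiffDeriv (φ c) (V c)) (hV' : ∀ c, IsDiffDeriv (φ c) (V' c)) :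
    (diffMatrix φ V').det - (diffMatrix φ V).det ∈ J := by
  -- the columns are changed one after another
  have key : ∀ S : Finset (Fin n ⊕ Unit),
      (diffMatrix φ fun c => if c ∈ S then V' c else V c).det - (diffMatrix φ V).det ∈ J := by
    intro S
    induction S using Finset.induction_on with
    | empty => simp
    | insert a S ha ih =>
      set W := fun c => if c ∈ S then V' c else V c with hW
      have hWd : ∀ c, IsDiffDeriv (φ c) (W c) := by
        intro c
        by_cases hc : c ∈ S
        · simpa [hW, hc] using hV' c
        · simpa [hW, hc] using hV c
      have h1 : (diffMatrix φ fun c => if c ∈ insert a S then V' c else V c) =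
          (diffMatrix φ W).updateCol a
            ((fun l => diffMatrix φ W l a) + Sum.elim (V' a - V a) 0) := by
        ext1 l c
        by_cases hc : c = a
        · subst hc
          rcases l with l | l <;> simp [diffMatrix, hW, ha]
        · rw [updateCol_ne hc]
          simp [diffMatrix, hW, hc]
      have h2 := det_updateCol_mem_of_relation hJ hWd a (w := V' a - V a)
        (fun j => Submodule.sub_mem _ ((hV' a).2 j) ((hV a).2 j)) (by
          simp only [Pi.sub_apply, mul_sub, Finset.sum_sub_distrib]
          rw [← (hV a).1, ← (hV' a).1, sub_self])
      rw [h1, det_updateCol_add, updateCol_eq_self, add_comm, add_sub_assoc]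
      exact add_mem h2 ih
  simpa using key Finset.univ

end DiffMatrix

/-! ### The extension operation -/

section Extension

open Matrix

variable {R : Type*} [CommRing R] {n : ℕ} {f : Fin n → MvPolynomial (Fin n) R}

theorem mul_mem_boundedIdeal (i : Fin n) {d : ℤ} {P : MvPolynomial (Fin n) R}
    (hP : P ∈ degLE (Fin n) R (d - (f i).totalDegree)) : f i * P ∈ boundedIdeal f d := by
  refine ⟨Pi.single i P, fun j => ?_, ?_⟩
  · by_cases hj : j = i
    · subst hj
      simpa using hP
    · simp [hj]
  · rw [Finset.sum_eq_single i (fun j _ hj => by simp [hj]) (by simp), Pi.single_eq_same]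

theorem boundedIdeal_mono {a b : ℤ} (h : a ≤ b) : boundedIdeal f a ⊆ boundedIdeal f b := by
  rintro _ ⟨g, hg, rfl⟩
  exact ⟨g, fun i => degLE_mono (by omega) (hg i), rfl⟩

theorem boundedIdeal_subset_truncIdeal (d : ℤ) : boundedIdeal f d ⊆ truncIdeal f d := by
  rintro _ ⟨g, hg, rfl⟩
  refine ⟨Ideal.sum_mem _ fun i _ => Ideal.mul_mem_right _ _
    (Ideal.subset_span (Set.mem_range_self i)), Submodule.sum_mem _ fun i _ => ?_⟩
  exact degLE_mono (by omega) (mul_mem_degLE (mem_degLE_totalDegree (f i)) (hg i))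

theorem applyY_inY_sys_mul_mem_degLE {L : Module.Dual R (MvPolynomial (Fin n) R)} {b e : ℤ}
    (hL : Annuls L (boundedIdeal f b)) (i : Fin n) {G : MvPolynomial (Fin n ⊕ Fin n) R}
    (hG : G ∈ degLE (Fin n ⊕ Fin n) R e) :
    applyY L (inY (f i) * G) ∈ degLE (Fin n) R (e + (f i).totalDegree - b - 1) :=
  degLE_mono (by omega) (applyY_inY_mul_mem_degLE L
    (fun P hP => hL _ (mul_mem_boundedIdeal i hP)) hG)

theorem isDiffDeriv_sumElim (C : NablaChoice f) (F : MvPolynomial (Fin n) R) (c : Fin n ⊕ Unit) :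
    IsDiffDeriv ((Sum.elim f fun _ => F : Fin n ⊕ Unit → MvPolynomial (Fin n) R) c)
      ((Sum.elim C.nablaSys fun _ => C.nabla F :
        Fin n ⊕ Unit → Fin n → MvPolynomial (Fin n ⊕ Fin n) R) c) := by
  rcases c with i | i
  exacts [C.isDiffDeriv_nablaSys i, C.isDiffDeriv_nabla F]

theorem starPoly_eq_applyY_det (C : NablaChoice f) (L : Module.Dual R (MvPolynomial (Fin n) R))
    (F : MvPolynomial (Fin n) R) :
    starPoly C L F = applyY L (diffMatrix (Sum.elim f fun _ => F)
      (Sum.elim C.nablaSys fun _ => C.nabla F)).det := by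
  have h : borderedMatrix C F = diffMatrix (Sum.elim f fun _ => F)
      (Sum.elim C.nablaSys fun _ => C.nabla F) := by
    ext1 l c
    rcases l with l | l <;> rcases c with c | c <;> rfl
  rw [← h]
  rfl

theorem sum_totalDegree_sub_one (F : MvPolynomial (Fin n) R) :
    ∑ c, ((((Sum.elim f fun _ => F : Fin n ⊕ Unit → MvPolynomial (Fin n) R) c).totalDegree : ℤ)
      - 1) + 1 = delta f + F.totalDegree := by
  simp [delta]
  ring

/-- Modulo the system, `L * F` is a multiple of `F`: in the last row of the determinant only `F(x)`
survives, and its cofactor does not depend on `F`. -/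
theorem starPoly_sub_mul_starPoly_one_mem (C : NablaChoice f)
    (L : Module.Dual R (MvPolynomial (Fin n) R)) (F : MvPolynomial (Fin n) R) :
    starPoly C L F - F * starPoly C L 1 ∈ sysIdeal f := by
  obtain ⟨D, hD⟩ : ∃ D, ∀ G, starPoly C L G - G * D ∈ sysIdeal f := by
    refine ⟨applyY L ((diffMatrix (Sum.elim f fun _ => 0)
      (Sum.elim C.nablaSys fun _ => 0)).updateCol (Sum.inr ()) (Pi.single (Sum.inr ()) 1)).det,
      fun G => ?_⟩
    have h : (diffMatrix (Sum.elim f fun _ => G)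
        (Sum.elim C.nablaSys fun _ => C.nabla G)).updateCol (Sum.inr ())
        (Pi.single (Sum.inr ()) 1) = (diffMatrix (Sum.elim f fun _ => 0)
        (Sum.elim C.nablaSys fun _ => 0)).updateCol (Sum.inr ()) (Pi.single (Sum.inr ()) 1) := by
      ext1 l c
      rcases l with l | l <;> rcases c with c | c <;> simp [diffMatrix]
    rw [starPoly_eq_applyY_det, det_diffMatrix_eq_sum_inX, Fintype.sum_sum_type]
    simp only [Finset.univ_unique, Finset.sum_singleton, Sum.elim_inl, Sum.elim_inr,
      PUnit.default_eq_unit]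
    rw [det_updateRow_single_eq _ (Sum.inr ()) (Sum.inr ()), h, map_add, applyY_inX_mul,
      add_sub_cancel_right, map_sum]
    refine Ideal.sum_mem _ fun i _ => ?_
    rw [applyY_inX_mul]
    exact Ideal.mul_mem_right _ _ (Ideal.subset_span (Set.mem_range_self i))
  have h : starPoly C L F - F * starPoly C L 1 =
      (starPoly C L F - F * D) - F * (starPoly C L 1 - 1 * D) := by ring
  rw [h]
  exact Ideal.sub_mem _ (hD F) (Ideal.mul_mem_left _ _ (hD 1))

/-- Modulo the system, `L * 1` does not depend on the difference derivatives. -/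
theorem starPoly_one_sub_starPoly_one_mem (C C' : NablaChoice f)
    {L : Module.Dual R (MvPolynomial (Fin n) R)} (hL : Annuls L (boundedIdeal f (delta f))) :
    starPoly C' L 1 - starPoly C L 1 ∈ sysIdeal f := by
  rw [starPoly_eq_applyY_det, starPoly_eq_applyY_det, ← map_sub]
  refine det_diffMatrix_sub_mem
    (J := (sysIdeal f).toAddSubgroup.comap (applyY L).toAddMonoidHom) ?_
    (isDiffDeriv_sumElim C 1) (isDiffDeriv_sumElim C' 1)
  intro m m' hmm' g hg
  rw [sum_totalDegree_sub_one] at hg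
  change applyY L _ ∈ sysIdeal f
  rw [mul_comm (inY _), mul_assoc, applyY_inX_mul]
  rcases m' with i' | i'
  · exact Ideal.mul_mem_right _ _ (Ideal.subset_span (Set.mem_range_self i'))
  · rcases m with i | i
    · rw [Sum.elim_inl, Sum.elim_inr] at hg
      rw [Sum.elim_inl, eq_zero_of_mem_degLE (by omega) (applyY_inY_sys_mul_mem_degLE hL i hg),
        mul_zero]
      exact Ideal.zero_mem _
    · exact absurd rfl hmm'

theorem sub_starPoly_mem_sysIdeal {E : Module.Dual R (MvPolynomial (Fin n) R)}
    (hE : Annuls E (boundedIdeal f (delta f))) {C₀ : NablaChoice f}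
    (hE1 : starPoly C₀ E 1 - 1 ∈ sysIdeal f) (C : NablaChoice f) (F : MvPolynomial (Fin n) R) :
    F - starPoly C E F ∈ sysIdeal f := by
  have h : F - starPoly C E F = -(starPoly C E F - F * starPoly C E 1) -
      F * ((starPoly C E 1 - starPoly C₀ E 1) + (starPoly C₀ E 1 - 1)) := by ring
  rw [h]
  exact Ideal.sub_mem _ (Ideal.neg_mem_iff _ |>.2 (starPoly_sub_mul_starPoly_one_mem C E F))
    (Ideal.mul_mem_left _ _ (Ideal.add_mem _ (starPoly_one_sub_starPoly_one_mem C₀ C hE) hE1))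

theorem starPoly_mem_degLE (C : NablaChoice f) {L : Module.Dual R (MvPolynomial (Fin n) R)} {ε : ℤ}
    (hL : Annuls L (boundedIdeal f (delta f + ε))) {d : ℤ} {F : MvPolynomial (Fin n) R}
    (hF : F ∈ degLE (Fin n) R d) :
    starPoly C L F ∈ degLE (Fin n) R (max (delta f) (d - ε - 1)) := by
  by_cases h0 : F = 0
  · subst h0
    rw [starPoly, map_zero]
    exact Submodule.zero_mem _
  have hd := totalDegree_le_of_mem_degLE hF h0
  have hV := isDiffDeriv_sumElim C F
  rw [starPoly_eq_applyY_det, det_diffMatrix_eq_sum_inY hV, map_sum]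
  refine Submodule.sum_mem _ fun c _ => ?_
  have h := cofactor_diffMatrix_mem_degLE hV c
  rw [sum_totalDegree_sub_one] at h
  rcases c with i | i
  · rw [Sum.elim_inl] at h
    exact degLE_mono (le_max_of_le_right (by omega)) (applyY_inY_sys_mul_mem_degLE hL i h)
  · rw [Sum.elim_inr, add_sub_cancel_right] at h
    exact degLE_mono (le_max_left _ _) (applyY_inY_mul_mem_degLE_self L _ h)

/-- The exchange of `x` and `y` turns the determinant of the extension operation into that of another
choice of the difference derivatives. -/
theorem rename_swap_det_diffMatrix {φ : Fin n ⊕ Unit → MvPolynomial (Fin n) R}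
    {V : Fin n ⊕ Unit → Fin n → MvPolynomial (Fin n ⊕ Fin n) R}
    (hV : ∀ c, IsDiffDeriv (φ c) (V c)) :
    ∃ V' : Fin n ⊕ Unit → Fin n → MvPolynomial (Fin n ⊕ Fin n) R,
      (∀ c, IsDiffDeriv (φ c) (V' c)) ∧
      rename Sum.swap (diffMatrix φ V).det = (diffMatrix φ V').det := by
  have hX : ∀ P : MvPolynomial (Fin n) R, rename Sum.swap (inX P) = inY P := fun P => by
    rw [inX, inY, rename_rename]
    rfl
  have hY : ∀ P : MvPolynomial (Fin n) R, rename Sum.swap (inY P) = inX P := fun P => by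
    rw [inX, inY, rename_rename]
    rfl
  have hV' : ∀ c, IsDiffDeriv (φ c) fun j => rename Sum.swap (V c j) := by
    refine fun c => ⟨?_, fun j => rename_mem_degLE _ ((hV c).2 j)⟩
    have h := congrArg (rename Sum.swap) (hV c).1
    rw [map_sub, hX, hY, map_sum] at h
    rw [← neg_sub, h, ← Finset.sum_neg_distrib]
    refine Finset.sum_congr rfl fun j _ => ?_
    simp only [map_mul, map_sub, rename_X, Sum.swap_inl, Sum.swap_inr]
    ring
  refine ⟨_, hV', ?_⟩
  rw [det_diffMatrix_eq_det_updateRow hV', AlgHom.map_det]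
  congr 1
  ext1 l c
  rcases l with l | l
  · simp [diffMatrix]
  · simp [diffMatrix, hX]

/-- The extension operation of functionals commutes, for any difference derivatives, up to a degree
which grows with the degrees up to which the functionals annul the system. After the exchange of `x`
and `y` in one of the two determinants, their difference consists of terms `f_i(y) f_j(x) x^α y^β`,
`F(y) f_j(x) x^α y^β` and `f_i(y) F(x) x^α y^β`, and their degrees are so small that `L` kills
`f_i(y) y^β` or `A` kills `f_j(x) x^α`. -/
theorem starFun_comm (C C' : NablaChoice f) {A L : Module.Dual R (MvPolynomial (Fin n) R)} {a b : ℤ}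
    (ha : delta f ≤ a) (hb : delta f ≤ b) (hA : Annuls A (boundedIdeal f a))
    (hL : Annuls L (boundedIdeal f b)) :
    EqUpTo (a + b + 1 - delta f) (starFun C A L) (starFun C' L A) := by
  intro F hF
  by_cases h0 : F = 0
  · rw [h0, map_zero, map_zero]
  have hd := totalDegree_le_of_mem_degLE hF h0
  change A (starPoly C L F) = L (starPoly C' A F)
  obtain ⟨V, hV, hVdet⟩ := rename_swap_det_diffMatrix (isDiffDeriv_sumElim C' F)
  rw [starPoly_eq_applyY_det, starPoly_eq_applyY_det, apply_applyY_comm A L, hVdet, ← sub_eq_zero,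
    ← map_sub, ← map_sub]
  refine det_diffMatrix_sub_mem
    (J := (LinearMap.ker (A ∘ₗ applyY L)).toAddSubgroup) ?_ hV (isDiffDeriv_sumElim C F)
  intro m m' hmm' g hg
  rw [sum_totalDegree_sub_one] at hg
  change A (applyY L _) = 0
  rw [mul_comm (inY _), mul_assoc, applyY_inX_mul]
  rcases m' with j | j
  · refine hA _ (mul_mem_boundedIdeal j ?_)
    rcases m with i | i
    · rw [Sum.elim_inl, Sum.elim_inl] at hg
      exact degLE_mono (by omega) (applyY_inY_sys_mul_mem_degLE hL i hg)
    · rw [Sum.elim_inl, Sum.elim_inr] at hg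
      exact degLE_mono (by omega) (applyY_inY_mul_mem_degLE_self L F hg)
  · rcases m with i | i
    · rw [Sum.elim_inl, Sum.elim_inr] at hg
      rw [Sum.elim_inl, eq_zero_of_mem_degLE (by omega) (applyY_inY_sys_mul_mem_degLE hL i hg),
        mul_zero, map_zero]
    · exact absurd rfl hmm'

end Extension

end RootFunctional

open RootFunctional in
theorem theorem5 {R : Type*} [CommRing R] {n : ℕ} (f : Fin n → MvPolynomial (Fin n) R)
    (ε : ℕ) (E' : Module.Dual R (MvPolynomial (Fin n) R))
    (hE' : Annuls E' (boundedIdeal f (delta f + ε)))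
    (C₀ : NablaChoice f) (hE'1 : starPoly C₀ E' 1 - 1 ∈ sysIdeal f) :
    -- the choices of difference derivatives may differ from one product to another
    ∀ C C' : NablaChoice f,
      (∀ (d : ℤ) (F : MvPolynomial (Fin n) R), F ∈ degLE (Fin n) R d →
        starPoly C E' F ∈ degLE (Fin n) R (max (delta f) (d - ε - 1)) ∧
        F - starPoly C E' F ∈ truncIdeal f (max (delta f) d)) ∧
      (∀ l : Module.Dual R (MvPolynomial (Fin n) R), Annuls l (sysIdeal f) →
        l = starFun C E' l ∧ l = starFun C' l E') ∧
      (∀ (l L' : Module.Dual R (MvPolynomial (Fin n) R)) (δ : ℕ), Annuls l (sysIdeal f) →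
        EqUpTo (delta f + δ) L' l →
        EqUpTo (delta f + δ + ε + 1) l (starFun C E' L') ∧
        EqUpTo (delta f + δ + ε + 1) l (starFun C' L' E')) ∧
      (∀ (L : Module.Dual R (MvPolynomial (Fin n) R)) (δ : ℕ),
        Annuls L (truncIdeal f (delta f + δ)) →
        EqUpTo (delta f + δ) L (starFun C E' L) ∧
        EqUpTo (delta f + δ) L (starFun C' L E') ∧
        EqUpTo (delta f + δ + ε + 1) (starFun C E' L) (starFun C' L E') ∧
        Annuls (starFun C E' L) (truncIdeal f (delta f + δ + ε + 1)) ∧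
        Annuls (starFun C' L E') (truncIdeal f (delta f + δ + ε + 1))) := by
  have hE0 : Annuls E' (boundedIdeal f (delta f)) :=
    fun F hF => hE' F (boundedIdeal_mono (by omega) hF)
  have starPoly_bounds : ∀ (C : NablaChoice f) (d : ℤ) (F : MvPolynomial (Fin n) R),
      F ∈ degLE (Fin n) R d →
      starPoly C E' F ∈ degLE (Fin n) R (max (delta f) (d - ε - 1)) ∧
      F - starPoly C E' F ∈ truncIdeal f (max (delta f) d) := by
    intro C d F hF
    have h := starPoly_mem_degLE C hE' hF
    exact ⟨h, sub_starPoly_mem_sysIdeal hE0 hE'1 C F, Submodule.sub_mem _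
      (degLE_mono (le_max_right _ _) hF) (degLE_mono (max_le_max_left _ (by omega)) h)⟩
  have star_comm_of_annuls : ∀ (C C' : NablaChoice f)
      (L : Module.Dual R (MvPolynomial (Fin n) R)) (δ : ℕ),
      Annuls L (truncIdeal f (delta f + δ)) →
      EqUpTo (delta f + δ) L (starFun C' L E') ∧
      EqUpTo (delta f + δ + ε + 1) (starFun C E' L) (starFun C' L E') ∧
      Annuls (starFun C' L E') (truncIdeal f (delta f + δ + ε + 1)) := by
    intro C C' L δ hL
    refine ⟨fun F hF => ?_, fun F hF => ?_, fun F hF => ?_⟩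
    · have h := (starPoly_bounds C' _ F hF).2
      rw [max_eq_right (by omega)] at h
      exact sub_eq_zero.1 ((map_sub L _ _).symm.trans (hL _ h))
    · exact starFun_comm C C' (a := delta f + ε) (b := delta f + δ) (by omega) (by omega) hE'
        (fun G hG => hL G (boundedIdeal_subset_truncIdeal _ hG)) F (degLE_mono (by omega) hF)
    · have h := (starPoly_bounds C' _ F hF.2).1
      refine hL _ ⟨?_, degLE_mono (max_le (by omega) (by omega)) h⟩
      have h2 := Ideal.sub_mem _ hF.1 (sub_starPoly_mem_sysIdeal hE0 hE'1 C' F)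
      rwa [sub_sub_cancel] at h2
  have right_unit : ∀ (C : NablaChoice f) (l : Module.Dual R (MvPolynomial (Fin n) R)),
      Annuls l (sysIdeal f) → ∀ F, l F = starFun C l E' F := fun C l hl F =>
    sub_eq_zero.1 ((map_sub l _ _).symm.trans (hl _ (sub_starPoly_mem_sysIdeal hE0 hE'1 C F)))
  intro C C'
  refine ⟨starPoly_bounds C, fun l hl => ?_, fun l L' δ hl hL' => ?_, fun L δ hL => ?_⟩
  · refine ⟨LinearMap.ext fun F => ?_, LinearMap.ext (right_unit C' l hl)⟩
    -- `l` annuls the truncations of the ideal in all degrees, in particular in one above `deg F`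
    obtain ⟨δ, hδ⟩ : ∃ δ : ℕ, (F.totalDegree : ℤ) ≤ delta f + δ :=
      ⟨(F.totalDegree - delta f).toNat, by omega⟩
    have h := (star_comm_of_annuls C C' l δ fun G hG => hl G hG.1).2.1 F
      (degLE_mono (by omega) (mem_degLE_totalDegree F))
    rw [h]
    exact right_unit C' l hl F
  · have h1 : EqUpTo (delta f + δ + ε + 1) l (starFun C' L' E') := fun F hF =>
      (right_unit C' l hl F).trans
        (hL' _ (degLE_mono (max_le (by omega) (by omega)) (starPoly_bounds C' _ F hF).1)).symm
    have h2 := (star_comm_of_annuls C C' L' δ fun G hG => (hL' G hG.2).trans (hl G hG.1)).2.1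
    exact ⟨fun F hF => (h1 F hF).trans (h2 F hF).symm, h1⟩
  · obtain ⟨h1, h2, h3⟩ := star_comm_of_annuls C C' L δ hL
    exact ⟨fun F hF => (h1 F hF).trans (h2 F (degLE_mono (by omega) hF)).symm, h1, h2,
      fun F hF => (h2 F hF.2).trans (h3 F hF), h3⟩
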